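/- For $v\in[0,+\infty)$ and $\alpha\in(0,+\infty)$ define $$T_{v,\alpha} := \frac{\alpha^{-1-\frac{v}{2}}}{2} \sum_{m=0}^{+\infty} \frac{\tanh\big(\alpha (1+2m)\frac{\pi}{2}\big)}{(1+2m)^{3+v}} + e^{\pi i \frac{v}{2}}\, \frac{\alpha^{1+\frac{v}{2}}}{2} \sum_{m=0}^{+\infty} \frac{\tanh\big(\alpha^{-1} (1+2m)\frac{\pi}{2}\big)}{(1+2m)^{3+v}}, \qquad T_{v} := \sum_{m=0}^{+\infty} \frac{\tanh\big(\frac{(1+2m)\pi}{2}\big)}{(1+2m)^{3+v}}$$ (all these series converge). **Theorem.** Let $\alpha\in(0,+\infty)$. For every integer $v\ge 0$, $$T_{2v,\alpha} = \frac{1}{(2v)!}\, \frac{\pi^{3+2v}}{4^{v+3}(v+1)(2v+1)}\, \frac{\big(\sqrt{\alpha}+\frac{i}{\sqrt{\alpha}}\big)^{2+2v} - \big(\sqrt{\alpha} - \frac{i}{\sqrt{\alpha}}\big)^{2+2v}}{2i} - \sum_{q=0}^{v-1} \frac{\pi^{2v-2q}}{(2v-2q)!\, 4^{v-q}}\, \frac{\big(\sqrt{\alpha}+\frac{i}{\sqrt{\alpha}}\big)^{2v-2q}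 + \big(\sqrt{\alpha} - \frac{i}{\sqrt{\alpha}}\big)^{2v-2q}}{2}\,T_{2q,\alpha},$$ with the initial condition $T_{0,\alpha} = \frac{\pi^{3}}{32}$. In particular, $$T_{2,\alpha} = \pi^{5}\, \frac{\frac{1}{\alpha}-\alpha}{384}, \qquad T_{4,\alpha} = \pi^{7}\, \frac{6\big(\frac{1}{\alpha^{2}}+\alpha^{2}\big)-5}{23040}, \qquad T_{6,\alpha} = \pi^{9}\, \frac{17\big(\frac{1}{\alpha^{3}}-\alpha^{3}\big)-14\big(\frac{1}{\alpha}-\alpha\big)}{645120},$$ $$T_{8,\alpha} = \pi^{11}\, \frac{310\big(\frac{1}{\alpha^{4}}+\alpha^{4}\big) - 255\big(\frac{1}{\alpha^{2}} + \alpha^{2}\big) + 252}{116121600}, \qquad T_{10,\alpha} = \pi^{13}\, \frac{2073\big(\frac{1}{\alpha^{5}}-\alpha^{5}\big) - 1705 \big(\frac{1}{\alpha^{3}}-\alpha^{3}\big) + 1683\big(\frac{1}{\alpha}-\alpha\big)}{7664025600}.$$ Moreover, in the case $\alpha=1$, for every integer $v\ge 0$, $$T_{4v} = \frac{(-1)^{v}\pi^{4v+3}}{(4v)!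 \, 4^{v+2}(4v+1)(4v+2)} - \sum_{q=0}^{v-1} \frac{(-1)^{v-q}\pi^{4(v-q)}}{(4(v-q))!\, 4^{v-q}}\,T_{4q},$$ with the initial condition $T_0=\frac{\pi^3}{32}$. In particular, $$T_{0} = \frac{\pi^{3}}{32}, \qquad T_{4} = \frac{7\pi^{7}}{23040}, \qquad T_{8} = \frac{181\, \pi^{11}}{58060800}, \qquad T_{12} = \frac{178559\, \pi^{15}}{5579410636800}.$$ -/

import Mathlib

open Real Finset

noncomputable section

/-- The `m`-th term of the series `∑ tanh(α (1+2m) π/2) / (1+2m)^(3+v)`, with real `v`. -/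
def tanhTerm (v α : ℝ) (m : ℕ) : ℝ :=
  Real.tanh (α * (1 + 2 * (m : ℝ)) * (π / 2)) / (1 + 2 * (m : ℝ)) ^ (3 + v)

/-- The complex number `T_{v,α}`, for real `v ≥ 0` and `α > 0`. -/
def TSeries (v α : ℝ) : ℂ :=
  ((α ^ (-1 - v / 2) / 2 * ∑' m : ℕ, tanhTerm v α m : ℝ) : ℂ)
    + Complex.exp ((π : ℂ) * Complex.I * ((v : ℂ) / 2))
      * ((α ^ (1 + v / 2) / 2 * ∑' m : ℕ, tanhTerm v α⁻¹ m : ℝ) : ℂ)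

/-- The real number `T_v = ∑ tanh((1+2m) π/2) / (1+2m)^(3+v)`, for real `v ≥ 0`. -/
def TSquare (v : ℝ) : ℝ :=
  ∑' m : ℕ, Real.tanh ((1 + 2 * (m : ℝ)) * π / 2) / (1 + 2 * (m : ℝ)) ^ (3 + v)

/-- The complex number `√α + i/√α`. -/
def wPlus (α : ℝ) : ℂ := (√α : ℂ) + Complex.I / (√α : ℂ)

/-- The complex number `√α - i/√α`. -/
def wMinus (α : ℝ) : ℂ := (√α : ℂ) - Complex.I / (√α : ℂ)

end

/-! The partial fractions of tanh turn each half of T_{2k,α} into a double series over odd m, n with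
denominator m^(2k+2) (α²m² + n²). After exchanging m and n in the second half, both halves share the
factor α²m² + n². Up to powers of α, their combination is (a^(k+1) - b^(k+1)) / (a - b) with a =
1/m², b = -α²/n². This is a finite geometric sum, so the double series decouples
(`tanhKernel_add_swap`) and T_{2k,α} becomes a finite convolution of the values λ(s) = `oddZeta s`
at even s (`TSeries_two_mul`).

Euler's formula for λ(2j) gives the generating series L(X) = ∑ λ(2j+2) X^(2j) = π tan(πX/2) / (4X).
The convolution is the coefficient of X^(2k) in L(cX) L(dX) with c = 1/√α, d = i√α, since c² = 1/α
and d² = -α. Clearing the two cosines and using product-to-sum leaves only the frequencies c ± d,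
which are √α ± i/√α up to a unit; comparing coefficients is the recursion (`sum_TSeries_eq`). -/

/-! ### Partial fractions of coth and tanh -/

theorem summable_inv_sq_add_succ_sq (x : ℝ) :
    Summable fun n : ℕ => 1 / (x ^ 2 + ((n : ℝ) + 1) ^ 2) := by
  have h : Summable fun n : ℕ => 1 / ((n : ℝ) + 1) ^ 2 := by
    simpa using (summable_nat_add_iff 1).2 (Real.summable_one_div_nat_pow.2 one_lt_two)
  refine h.of_nonneg_of_le (fun n => by positivity) fun n => ?_
  gcongr
  nlinarith [sq_nonneg x]

/-- The partial fraction expansion of the hyperbolic cotangent. -/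
theorem pi_mul_cosh_div_sinh_pi_mul {y : ℝ} (hy : 0 < y) :
    π * (Real.cosh (π * y) / Real.sinh (π * y)) =
      1 / y + 2 * y * ∑' n : ℕ, 1 / (y ^ 2 + ((n : ℝ) + 1) ^ 2) := by
  -- The expansion of coth is that of π cot(πz) at z = iy.
  have hz : (Complex.I * y : ℂ) ∈ Complex.integerComplement := by
    refine UpperHalfPlane.coe_mem_integerComplement ⟨Complex.I * y, by simpa using hy⟩
  have h := cot_series_rep' hz
  have hy' : (y : ℂ) ≠ 0 := by exact_mod_cast hy.ne'
  have hs : Complex.sinh (π * y) ≠ 0 := by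
    rw [← Complex.ofReal_mul, ← Complex.ofReal_sinh]
    exact_mod_cast (Real.sinh_pos_iff.2 (by positivity)).ne'
  have e : ∀ n : ℕ, 1 / (Complex.I * y - ((n : ℂ) + 1)) + 1 / (Complex.I * y + ((n : ℂ) + 1)) =
      (-2 * Complex.I * y) * ((1 / (y ^ 2 + ((n : ℝ) + 1) ^ 2) : ℝ) : ℂ) := by
    intro n
    have h0 : (y : ℂ) ^ 2 + ((n : ℂ) + 1) ^ 2 ≠ 0 := by
      have : y ^ 2 + ((n : ℝ) + 1) ^ 2 ≠ 0 := by positivity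
      exact_mod_cast this
    have hf : (Complex.I * y - ((n : ℂ) + 1)) * (Complex.I * y + ((n : ℂ) + 1)) =
        -((y : ℂ) ^ 2 + ((n : ℂ) + 1) ^ 2) := by
      linear_combination (y : ℂ) ^ 2 * Complex.I_sq
    have h1 : (Complex.I * y - ((n : ℂ) + 1)) ≠ 0 := by
      rintro h1; rw [h1, zero_mul] at hf; exact h0 (neg_eq_zero.1 hf.symm)
    have h2 : (Complex.I * y + ((n : ℂ) + 1)) ≠ 0 := by
      rintro h1; rw [h1, mul_zero] at hf; exact h0 (neg_eq_zero.1 hf.symm)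
    rw [div_add_div _ _ h1 h2, hf]
    push_cast
    field_simp
    ring
  rw [tsum_congr e, tsum_mul_left, ← Complex.ofReal_tsum, Complex.cot,
    show (π : ℂ) * (Complex.I * y) = (π * y) * Complex.I by ring, Complex.cos_mul_I,
    Complex.sin_mul_I] at h
  rw [← Complex.ofReal_inj]
  push_cast at h ⊢
  have key : (π : ℂ) * (Complex.cosh (π * y) / Complex.sinh (π * y)) - 1 / y =
      Complex.I * (π * (Complex.cosh (π * y) / (Complex.sinh (π * y) * Complex.I)) -
        1 / (Complex.I * y)) := by
    field_simp
  rw [sub_eq_iff_eq_add'.1 key, h]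
  linear_combination (-2 * (y : ℂ) * ∑' n : ℕ, 1 / ((y : ℂ) ^ 2 + ((n : ℂ) + 1) ^ 2)) *
    Complex.I_sq

/-- The partial fraction expansion of the hyperbolic tangent. -/
theorem tanh_mul_pi_div_two {x : ℝ} (hx : 0 < x) :
    Real.tanh (x * (π / 2)) = 4 * x / π * ∑' n : ℕ, 1 / (x ^ 2 + (1 + 2 * (n : ℝ)) ^ 2) := by
  have h1 := pi_mul_cosh_div_sinh_pi_mul hx
  have h2 := pi_mul_cosh_div_sinh_pi_mul (half_pos hx)
  have hsum := summable_inv_sq_add_succ_sq x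
  have he : Function.Injective fun n : ℕ => 2 * n := fun a b h => by simpa using h
  have ho : Function.Injective fun n : ℕ => 2 * n + 1 := fun a b h => by simpa using h
  have hsplit : ∑' n : ℕ, 1 / (x ^ 2 + (((2 * n : ℕ) : ℝ) + 1) ^ 2) +
      ∑' n : ℕ, 1 / (x ^ 2 + (((2 * n + 1 : ℕ) : ℝ) + 1) ^ 2) =
        ∑' n : ℕ, 1 / (x ^ 2 + ((n : ℝ) + 1) ^ 2) :=
    tsum_even_add_odd (f := fun n : ℕ => 1 / (x ^ 2 + ((n : ℝ) + 1) ^ 2))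
      (hsum.comp_injective he) (hsum.comp_injective ho)
  have e1 : ∀ n : ℕ, 1 / (x ^ 2 + (((2 * n : ℕ) : ℝ) + 1) ^ 2) =
      1 / (x ^ 2 + (1 + 2 * (n : ℝ)) ^ 2) := fun n => by push_cast; ring_nf
  have e2 : ∀ n : ℕ, 1 / (x ^ 2 + (((2 * n + 1 : ℕ) : ℝ) + 1) ^ 2) =
      1 / 4 * (1 / ((x / 2) ^ 2 + ((n : ℝ) + 1) ^ 2)) := fun n => by
    push_cast
    rw [div_mul_div_comm, one_mul]
    congr 1
    ring
  rw [tsum_congr e1, tsum_congr e2, tsum_mul_left] at hsplit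
  rw [← hsplit] at h1
  generalize (∑' n : ℕ, 1 / (x ^ 2 + (1 + 2 * (n : ℝ)) ^ 2)) = A at *
  generalize (∑' n : ℕ, 1 / ((x / 2) ^ 2 + ((n : ℝ) + 1) ^ 2)) = B at *
  have hs : Real.sinh (π * (x / 2)) ≠ 0 := (Real.sinh_pos_iff.2 (by positivity)).ne'
  have hc : Real.cosh (π * (x / 2)) ≠ 0 := (Real.cosh_pos _).ne'
  -- This is tanh u = 2 coth 2u - coth u with u = πx/2; subtracting the coth u expansion removes the
  -- even integers.
  have ht : π * Real.tanh (x * (π / 2)) = 2 * (π * (Real.cosh (π * x) / Real.sinh (π * x))) -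
      π * (Real.cosh (π * (x / 2)) / Real.sinh (π * (x / 2))) := by
    rw [show π * x = 2 * (π * (x / 2)) by ring, Real.cosh_two_mul, Real.sinh_two_mul,
      show x * (π / 2) = π * (x / 2) by ring, Real.tanh_eq_sinh_div_cosh]
    field_simp
    ring
  rw [h1, h2] at ht
  have h : π * Real.tanh (x * (π / 2)) = 4 * x * A := by
    rw [ht]
    field_simp
    ring
  rw [div_mul_eq_mul_div, eq_div_iff Real.pi_ne_zero, mul_comm, h]

/-! ### The double series and its decoupling -/

noncomputable section

/-- The Dirichlet lambda value `∑ 1 / (1 + 2 n) ^ s` over odd integers. -/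
def oddZeta (s : ℕ) : ℝ := ∑' n : ℕ, 1 / (1 + 2 * (n : ℝ)) ^ s

theorem summable_one_div_odd_pow {s : ℕ} (hs : 1 < s) :
    Summable fun n : ℕ => 1 / (1 + 2 * (n : ℝ)) ^ s := by
  have h := (Real.summable_one_div_nat_pow.2 hs).comp_injective
    (i := fun n : ℕ => 2 * n + 1) fun a b h => by simpa using h
  refine h.congr fun n => ?_
  simp [add_comm]

/-- The general term of the double series for `∑ tanh(α n π / 2) / n ^ (2 k + 3)`. -/
def tanhKernel (k : ℕ) (α : ℝ) (p : ℕ × ℕ) : ℝ :=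
  1 / ((1 + 2 * (p.1 : ℝ)) ^ (2 * k + 2) *
    (α ^ 2 * (1 + 2 * (p.1 : ℝ)) ^ 2 + (1 + 2 * (p.2 : ℝ)) ^ 2))

/-- Dropping α²m² from the denominator leaves the product of two convergent series. -/
theorem summable_tanhKernel (k : ℕ) (α : ℝ) : Summable (tanhKernel k α) := by
  have h2 := summable_one_div_odd_pow one_lt_two
  have hk := summable_one_div_odd_pow (show 1 < 2 * k + 2 by lia)
  refine (hk.mul_of_nonneg h2 (fun n => by positivity) fun n => by positivity).of_nonneg_of_le
    (fun p => by unfold tanhKernel; positivity) fun p => ?_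
  unfold tanhKernel
  rw [one_div_mul_one_div]
  gcongr
  nlinarith [mul_nonneg (sq_nonneg α) (sq_nonneg (1 + 2 * (p.1 : ℝ)))]

theorem tanhTerm_two_mul {α : ℝ} (hα : 0 < α) (k m : ℕ) :
    tanhTerm (2 * (k : ℝ)) α m = 4 * α / π * ∑' n : ℕ, tanhKernel k α (m, n) := by
  have hm : (0 : ℝ) < 1 + 2 * m := by positivity
  have hp : (1 + 2 * (m : ℝ)) ^ (3 + 2 * (k : ℝ)) = (1 + 2 * (m : ℝ)) ^ (2 * k + 3) := by
    rw [← Real.rpow_natCast]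
    push_cast
    ring_nf
  rw [tanhTerm, tanh_mul_pi_div_two (by positivity), hp]
  simp only [tanhKernel, ← one_div_mul_one_div, mul_pow]
  rw [tsum_mul_left]
  generalize (∑' n : ℕ, 1 / (α ^ 2 * (1 + 2 * (m : ℝ)) ^ 2 + (1 + 2 * (n : ℝ)) ^ 2)) = S
  have hpi := Real.pi_pos
  field_simp
  ring

theorem tsum_tanhTerm_two_mul {α : ℝ} (hα : 0 < α) (k : ℕ) :
    ∑' m : ℕ, tanhTerm (2 * (k : ℝ)) α m = 4 * α / π * ∑' p : ℕ × ℕ, tanhKernel k α p := by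
  rw [tsum_congr (tanhTerm_two_mul hα k), tsum_mul_left, (summable_tanhKernel k α).tsum_prod]

/-- With a = 1/m² and b = -α²/n², one has a - b = (α²m² + n²)/(m²n²), so the common denominator
divides a^(k+1) - b^(k+1) out into a geometric sum whose terms separate m from n. -/
theorem tanhKernel_add_swap {α : ℝ} (hα : 0 < α) (k : ℕ) (p : ℕ × ℕ) :
    α⁻¹ ^ k * tanhKernel k α p + (-1) ^ k * α ^ k * tanhKernel k α⁻¹ p.swap =
      ∑ j ∈ range (k + 1), α⁻¹ ^ j * (-α) ^ (k - j) *
        (1 / (1 + 2 * (p.1 : ℝ)) ^ (2 * j + 2) * (1 / (1 + 2 * (p.2 : ℝ)) ^ (2 * (k - j) + 2))) := by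
  have hm : (0 : ℝ) < 1 + 2 * p.1 := by positivity
  have hn : (0 : ℝ) < 1 + 2 * p.2 := by positivity
  simp only [tanhKernel, Prod.fst_swap, Prod.snd_swap]
  generalize (1 + 2 * (p.1 : ℝ)) = m at *
  generalize (1 + 2 * (p.2 : ℝ)) = n at *
  have hg := geom_sum₂_mul (1 / m ^ 2) (-α ^ 2 / n ^ 2) (k + 1)
  have hd : 0 < 1 / m ^ 2 - -α ^ 2 / n ^ 2 := by
    rw [neg_div, sub_neg_eq_add]; positivity
  have hs : ∑ j ∈ range (k + 1), α⁻¹ ^ j * (-α) ^ (k - j) *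
        (1 / m ^ (2 * j + 2) * (1 / n ^ (2 * (k - j) + 2))) =
      α⁻¹ ^ k / (m ^ 2 * n ^ 2) *
        ∑ j ∈ range (k + 1), (1 / m ^ 2) ^ j * (-α ^ 2 / n ^ 2) ^ (k + 1 - 1 - j) := by
    rw [mul_sum]
    refine sum_congr rfl fun j hj => ?_
    obtain ⟨i, rfl⟩ := Nat.exists_eq_add_of_le (Nat.lt_succ_iff.1 (mem_range.1 hj))
    rw [show j + i - j = i by lia, show j + i + 1 - 1 - j = i by lia, neg_pow α, neg_div,
      neg_pow (α ^ 2 / n ^ 2), div_pow, div_pow, one_pow, pow_add, pow_add, pow_add, pow_mul,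
      pow_mul, inv_pow, inv_pow]
    field_simp
    ring
  rw [hs, ← mul_right_inj' hd.ne', mul_left_comm _ (α⁻¹ ^ k / (m ^ 2 * n ^ 2)),
    mul_comm _ (∑ j ∈ range (k + 1), _), hg, neg_div, neg_pow (α ^ 2 / n ^ 2), div_pow, div_pow,
    sub_neg_eq_add, inv_pow, pow_add, pow_add, pow_mul, pow_mul, one_pow, inv_pow, pow_succ,
    pow_succ, pow_succ]
  field_simp
  ring

theorem sum_tsum_tanhKernel {α : ℝ} (hα : 0 < α) (k : ℕ) :
    α⁻¹ ^ k * ∑' p, tanhKernel k α p + (-1) ^ k * α ^ k * ∑' p, tanhKernel k α⁻¹ p =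
      ∑ j ∈ range (k + 1), (α⁻¹ ^ j * oddZeta (2 * j + 2)) *
        ((-α) ^ (k - j) * oddZeta (2 * (k - j) + 2)) := by
  have hswap : Summable fun p : ℕ × ℕ => tanhKernel k α⁻¹ p.swap :=
    (Equiv.prodComm ℕ ℕ).summable_iff.2 (summable_tanhKernel k α⁻¹)
  have he : ∑' p : ℕ × ℕ, tanhKernel k α⁻¹ p.swap = ∑' p, tanhKernel k α⁻¹ p :=
    (Equiv.prodComm ℕ ℕ).tsum_eq (tanhKernel k α⁻¹)
  have hprod (j : ℕ) := (summable_one_div_odd_pow (show 1 < 2 * j + 2 by lia)).mul_of_nonneg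
    (summable_one_div_odd_pow (show 1 < 2 * (k - j) + 2 by lia))
    (fun n => by positivity) fun n => by positivity
  rw [← he, ← tsum_mul_left, ← tsum_mul_left,
    ← ((summable_tanhKernel k α).mul_left _).tsum_add (hswap.mul_left _),
    tsum_congr (tanhKernel_add_swap hα k),
    Summable.tsum_finsetSum fun j _ => (hprod j).mul_left _]
  refine sum_congr rfl fun j _ => ?_
  rw [tsum_mul_left, oddZeta, oddZeta, mul_mul_mul_comm,
    (summable_one_div_odd_pow (show 1 < 2 * j + 2 by lia)).tsum_mul_tsum
      (summable_one_div_odd_pow (show 1 < 2 * (k - j) + 2 by lia)) (hprod j)]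

theorem exp_pi_mul_I_mul_two_mul_div_two (k : ℕ) :
    Complex.exp ((π : ℂ) * Complex.I * (((2 * (k : ℝ) : ℝ) : ℂ) / 2)) = (-1) ^ k := by
  rw [← Complex.exp_pi_mul_I, ← Complex.exp_nat_mul]
  congr 1
  push_cast
  ring

/-- `T_{2k,α}` as a finite convolution of sums over odd integers. -/
theorem TSeries_two_mul {α : ℝ} (hα : 0 < α) (k : ℕ) :
    TSeries (2 * (k : ℝ)) α =
      ((2 / π * ∑ j ∈ range (k + 1), (α⁻¹ ^ j * oddZeta (2 * j + 2)) *
        ((-α) ^ (k - j) * oddZeta (2 * (k - j) + 2)) : ℝ) : ℂ) := by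
  have h1 : α ^ (-1 - 2 * (k : ℝ) / 2) = α⁻¹ * α⁻¹ ^ k := by
    rw [show -1 - 2 * (k : ℝ) / 2 = -((k + 1 : ℕ) : ℝ) by push_cast; ring, Real.rpow_neg hα.le,
      Real.rpow_natCast, pow_succ, mul_inv, inv_pow, mul_comm]
  have h2 : α ^ (1 + 2 * (k : ℝ) / 2) = α * α ^ k := by
    rw [show 1 + 2 * (k : ℝ) / 2 = ((k + 1 : ℕ) : ℝ) by push_cast; ring,
      Real.rpow_natCast, pow_succ, mul_comm]
  rw [TSeries, exp_pi_mul_I_mul_two_mul_div_two, tsum_tanhTerm_two_mul hα,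
    tsum_tanhTerm_two_mul (inv_pos.2 hα), h1, h2, ← sum_tsum_tanhKernel hα]
  push_cast
  have hα' : (α : ℂ) ≠ 0 := by exact_mod_cast hα.ne'
  have hpi : (π : ℂ) ≠ 0 := by exact_mod_cast Real.pi_ne_zero
  field_simp
  ring
end

/-! ### Even values of λ and their generating series -/

noncomputable section

/-- Euler's formula for ζ(2k) with the even integers removed. The sign is absorbed in (iπ)^(2k), so
that the generating series is a rescaling by iπ. -/
theorem oddZeta_two_mul {k : ℕ} (hk : k ≠ 0) :
    (oddZeta (2 * k) : ℂ) =
      (Complex.I * π) ^ (2 * k) * (1 - 2 ^ (2 * k)) * bernoulli (2 * k) / (2 * (2 * k).factorial) := by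
  have hz := hasSum_zeta_nat hk
  have he : Function.Injective fun n : ℕ => 2 * n := fun a b h => by simpa using h
  have ho : Function.Injective fun n : ℕ => 2 * n + 1 := fun a b h => by simpa using h
  -- The term at 0 is 1/0 = 0, because k ≠ 0.
  have hsplit : ∑' n : ℕ, 1 / ((2 * n : ℕ) : ℝ) ^ (2 * k) +
      ∑' n : ℕ, 1 / ((2 * n + 1 : ℕ) : ℝ) ^ (2 * k) = ∑' n : ℕ, 1 / (n : ℝ) ^ (2 * k) :=
    tsum_even_add_odd (f := fun n : ℕ => 1 / (n : ℝ) ^ (2 * k))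
      (hz.summable.comp_injective he) (hz.summable.comp_injective ho)
  have e1 (n : ℕ) : 1 / ((2 * n : ℕ) : ℝ) ^ (2 * k) =
      1 / 2 ^ (2 * k) * (1 / (n : ℝ) ^ (2 * k)) := by
    rw [one_div_mul_one_div, ← mul_pow, Nat.cast_mul, Nat.cast_ofNat]
  have e2 (n : ℕ) : 1 / ((2 * n + 1 : ℕ) : ℝ) ^ (2 * k) = 1 / (1 + 2 * (n : ℝ)) ^ (2 * k) := by
    push_cast
    rw [add_comm]
  rw [tsum_congr e1, tsum_congr e2, tsum_mul_left, hz.tsum_eq, ← oddZeta] at hsplit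
  have hI : (Complex.I * π) ^ (2 * k) = (-1) ^ k * (π : ℂ) ^ (2 * k) := by
    rw [mul_pow, pow_mul Complex.I, Complex.I_sq]
  rw [eq_sub_iff_add_eq'.2 hsplit, hI]
  have h2 : (2 : ℂ) ^ (2 * k) = 2 * 2 ^ (2 * k - 1) := by
    rw [← pow_succ', Nat.sub_add_cancel (by lia)]
  push_cast
  have hf : ((2 * k).factorial : ℂ) ≠ 0 := by exact_mod_cast (Nat.factorial_pos _).ne'
  rw [h2, pow_succ]
  field_simp
  ring

open PowerSeries

theorem rescale_C_eq (c a : ℂ) : rescale c (C a) = C a := by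
  ext n
  rw [coeff_rescale, coeff_C]
  split_ifs with h <;> simp [h]

/-- The formal series `exp (a X)` over `ℂ`. -/
def expSeries (a : ℂ) : PowerSeries ℂ := rescale a (PowerSeries.exp ℂ)

theorem expSeries_mul (a b : ℂ) : expSeries a * expSeries b = expSeries (a + b) :=
  PowerSeries.exp_mul_exp_eq_exp_add a b

theorem expSeries_zero : expSeries 0 = 1 := by
  simp [expSeries]

theorem rescale_expSeries (c a : ℂ) : rescale c (expSeries a) = expSeries (a * c) := by
  rw [expSeries, rescale_rescale, expSeries]

theorem coeff_expSeries (a : ℂ) (n : ℕ) : coeff n (expSeries a) = a ^ n / n.factorial := by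
  simp [expSeries, coeff_rescale, coeff_exp, div_eq_mul_inv]

theorem expSeries_sub_one_ne_zero {a : ℂ} (ha : a ≠ 0) : expSeries a - 1 ≠ 0 := by
  intro h
  have := congrArg (coeff 1) h
  simp [coeff_expSeries, coeff_one, ha] at this

/-- The generating series `∑ oddZeta (2 j + 2) X ^ (2 j)`. -/
def oddZetaSeries : PowerSeries ℂ :=
  PowerSeries.mk fun n => if Even n then (oddZeta (n + 2) : ℂ) else 0

/-- The factor 1 - 2^n in Euler's formula is the difference of the Bernoulli series and its
rescaling by 2. Its only nonzero odd coefficient, 1/2 in degree 1, comes from B₁ = -1/2 and is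
subtracted. -/
theorem two_mul_X_sq_mul_oddZetaSeries :
    2 * X ^ 2 * oddZetaSeries = rescale (Complex.I * π)
      (bernoulliPowerSeries ℂ - rescale 2 (bernoulliPowerSeries ℂ) - C (1 / 2) * X) := by
  ext n
  rw [show (2 : PowerSeries ℂ) = C 2 from (map_ofNat C 2).symm, mul_assoc, coeff_C_mul, coeff_X_pow_mul',
    coeff_rescale, map_sub, map_sub, coeff_rescale, coeff_C_mul, coeff_X]
  simp only [bernoulliPowerSeries, coeff_mk, oddZetaSeries]
  rcases lt_or_ge n 2 with hn | hn
  · interval_cases n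
    · simp
    · simp; norm_num
  rw [if_pos hn, if_neg (by lia : n ≠ 1), Nat.sub_add_cancel hn]
  rcases Nat.even_or_odd n with he | ho
  · rw [if_pos ((Nat.even_sub hn).2 (by simp [he]))]
    obtain ⟨k, rfl⟩ := he
    rw [← two_mul, oddZeta_two_mul (by lia : k ≠ 0)]
    have hf : ((2 * k).factorial : ℂ) ≠ 0 := by exact_mod_cast (Nat.factorial_pos _).ne'
    simp only [eq_ratCast]
    push_cast
    field_simp
    ring
  · rw [if_neg (fun h => by rw [Nat.even_sub hn] at h; simp at h; exact Nat.not_even_iff_odd.2 ho h),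
      bernoulli_eq_zero_of_odd ho (by lia)]
    simp

/-- Formally, x/(e^x - 1) - 2x/(e^(2x) - 1) = x/(e^x + 1), because e^(2x) - 1 = (e^x - 1)(e^x + 1).
-/
theorem bernoulliPowerSeries_sub_rescale_mul :
    (bernoulliPowerSeries ℂ - rescale 2 (bernoulliPowerSeries ℂ)) * (expSeries 1 + 1) = X := by
  have h1 : bernoulliPowerSeries ℂ * (expSeries 1 - 1) = X := by
    simpa [expSeries] using bernoulliPowerSeries_mul_exp_sub_one ℂ
  have h2 : rescale 2 (bernoulliPowerSeries ℂ) * (expSeries 2 - 1) = C 2 * X := by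
    have := congrArg (rescale (2 : ℂ)) h1
    simpa [rescale_expSeries, rescale_X] using this
  have h3 : expSeries 2 = expSeries 1 * expSeries 1 := by
    rw [expSeries_mul]; norm_num
  refine mul_right_cancel₀ (expSeries_sub_one_ne_zero one_ne_zero) ?_
  rw [h3] at h2
  rw [show (C (2 : ℂ) : PowerSeries ℂ) = 2 from map_ofNat C 2] at h2
  linear_combination (expSeries 1 + 1) * h1 - h2

/-- `X * L * cosh (π i X / 2) = - (π i / 4) * sinh (π i X / 2)` for the generating series `L`. -/
theorem X_mul_oddZetaSeries_mul :
    C 4 * X * oddZetaSeries * (expSeries (Complex.I * π / 2) + expSeries (-(Complex.I * π / 2))) =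
      C (-(Complex.I * π)) *
        (expSeries (Complex.I * π / 2) - expSeries (-(Complex.I * π / 2))) := by
  have h := congrArg (rescale (Complex.I * π)) bernoulliPowerSeries_sub_rescale_mul
  have h0 := two_mul_X_sq_mul_oddZetaSeries
  have h1 : expSeries (Complex.I * π) = expSeries (Complex.I * π / 2) *
      expSeries (Complex.I * π / 2) := by
    rw [expSeries_mul]; ring_nf
  have h2 : expSeries (Complex.I * π / 2) * expSeries (-(Complex.I * π / 2)) = 1 := by
    rw [expSeries_mul, add_neg_cancel, expSeries_zero]
  rw [map_mul, map_add, rescale_expSeries, one_mul, map_one, rescale_X, h1] at h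
  rw [map_sub, map_mul, rescale_X, rescale_C_eq] at h0
  generalize rescale (Complex.I * π)
    (bernoulliPowerSeries ℂ - rescale 2 (bernoulliPowerSeries ℂ)) = G at *
  have h4 : (C (4 : ℂ) : PowerSeries ℂ) = 4 := map_ofNat C 4
  have h5 : (C (1 / 2 : ℂ) : PowerSeries ℂ) * 2 = 1 := by
    rw [show (2 : PowerSeries ℂ) = C 2 from (map_ofNat C 2).symm, ← map_mul]; norm_num
  rw [h4, map_neg]
  generalize expSeries (Complex.I * π / 2) = e at *
  generalize expSeries (-(Complex.I * π / 2)) = f at *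
  generalize C (Complex.I * (π : ℂ)) = c at *
  generalize C (1 / 2 : ℂ) = d at *
  refine mul_left_cancel₀ (X_ne_zero (R := ℂ)) ?_
  have hG : G = 2 * X ^ 2 * oddZetaSeries + d * (c * X) := by linear_combination -h0
  rw [hG] at h
  linear_combination (2 * f) * h + (-c * X * (e ^ 2 * f + f) * 1) * h5 +
    (-4 * X ^ 2 * oddZetaSeries * e - c * X * e) * h2

/-- The rescaled form of `X_mul_oddZetaSeries_mul`. -/
theorem X_mul_rescale_oddZetaSeries_mul (c : ℂ) :
    C (4 * c) * X * rescale c oddZetaSeries * (expSeries (Complex.I * π / 2 * c) +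
      expSeries (-(Complex.I * π / 2 * c))) = C (-(Complex.I * π)) *
        (expSeries (Complex.I * π / 2 * c) - expSeries (-(Complex.I * π / 2 * c))) := by
  have h := congrArg (rescale c) X_mul_oddZetaSeries_mul
  simp only [map_mul, map_add, map_sub, rescale_C_eq, rescale_X, rescale_expSeries, neg_mul] at h
  simp only [map_mul]
  linear_combination h

end

/-! ### Product-to-sum and the recursion -/

noncomputable section

theorem sum_range_two_mul_of_odd {M : Type*} [AddCommMonoid M] {f : ℕ → M} {n : ℕ}
    (hf : ∀ i < n, f (2 * i + 1) = 0) :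
    ∑ i ∈ range (2 * n), f i = ∑ i ∈ range n, f (2 * i) := by
  induction n with
  | zero => simp
  | succ n ih =>
    rw [mul_add, mul_one, sum_range_succ, sum_range_succ, ih fun i hi => hf i (by lia),
      hf n (by lia), add_zero, sum_range_succ _ n]

open PowerSeries in
theorem coeff_two_mul_mul_of_odd {R : Type*} [Semiring R] {f g : PowerSeries R}
    (hg : ∀ i, coeff (2 * i + 1) g = 0) (n : ℕ) :
    coeff (2 * n) (f * g) = ∑ i ∈ range (n + 1), coeff (2 * i) f * coeff (2 * (n - i)) g := by
  rw [coeff_mul, Nat.sum_antidiagonal_eq_sum_range_succ_mk, sum_range_succ,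
    sum_range_two_mul_of_odd, sum_range_succ]
  · simp only [mul_tsub]
  · intro i hi
    dsimp only
    rw [show 2 * n - (2 * i + 1) = 2 * (n - i - 1) + 1 by lia, hg, mul_zero]

open PowerSeries in
-- The product of the tangent identities at cX and dX, with cos·cos and sin·sin rewritten through c
-- + d and c - d.
theorem X_sq_mul_rescale_mul_rescale (c d : ℂ) :
    C (16 * (c * d)) * (X ^ 2 * (rescale c oddZetaSeries * rescale d oddZetaSeries *
      (expSeries (Complex.I * π / 2 * (c + d)) + expSeries (-(Complex.I * π / 2 * (c + d))) +
        (expSeries (Complex.I * π / 2 * (c - d)) + expSeries (-(Complex.I * π / 2 * (c - d))))))) =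
    C (-(π : ℂ) ^ 2) *
      (expSeries (Complex.I * π / 2 * (c + d)) + expSeries (-(Complex.I * π / 2 * (c + d))) -
        (expSeries (Complex.I * π / 2 * (c - d)) + expSeries (-(Complex.I * π / 2 * (c - d))))) := by
  have hc := X_mul_rescale_oddZetaSeries_mul c
  have hd := X_mul_rescale_oddZetaSeries_mul d
  have h1 : expSeries (Complex.I * π / 2 * (c + d)) =
    expSeries (Complex.I * π / 2 * c) * expSeries (Complex.I * π / 2 * d) := by
    rw [expSeries_mul, mul_add]
  have h2 : expSeries (-(Complex.I * π / 2 * (c + d))) =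
    expSeries (-(Complex.I * π / 2 * c)) * expSeries (-(Complex.I * π / 2 * d)) := by
    rw [expSeries_mul]; ring_nf
  have h3 : expSeries (Complex.I * π / 2 * (c - d)) =
    expSeries (Complex.I * π / 2 * c) * expSeries (-(Complex.I * π / 2 * d)) := by
    rw [expSeries_mul]; ring_nf
  have h4 : expSeries (-(Complex.I * π / 2 * (c - d))) =
    expSeries (-(Complex.I * π / 2 * c)) * expSeries (Complex.I * π / 2 * d) := by
    rw [expSeries_mul]; ring_nf
  have h5 : (C (16 * (c * d)) : PowerSeries ℂ) = C (4 * c) * C (4 * d) := by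
    rw [← map_mul]; ring_nf
  have h6 : (C (-(π : ℂ) ^ 2) : PowerSeries ℂ) = C (-(Complex.I * π)) * C (-(Complex.I * π)) := by
    rw [← map_mul]
    congr 1
    linear_combination (-(π : ℂ) ^ 2) * Complex.I_sq
  rw [h1, h2, h3, h4, h5, h6]
  generalize C (-(Complex.I * (π : ℂ))) = k at *
  linear_combination (C (4 * d) * X * rescale d oddZetaSeries *
    (expSeries (Complex.I * π / 2 * d) + expSeries (-(Complex.I * π / 2 * d)))) * hc +
    (k * (expSeries (Complex.I * π / 2 * c) - expSeries (-(Complex.I * π / 2 * c)))) * hd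

open PowerSeries in
theorem coeff_expSeries_add_neg_even (a : ℂ) (n : ℕ) :
    coeff (2 * n) (expSeries a + expSeries (-a)) = 2 * a ^ (2 * n) / (2 * n).factorial := by
  rw [map_add, coeff_expSeries, coeff_expSeries, Even.neg_pow (by simp)]
  ring

open PowerSeries in
theorem coeff_expSeries_add_neg_odd (a : ℂ) (n : ℕ) :
    coeff (2 * n + 1) (expSeries a + expSeries (-a)) = 0 := by
  rw [map_add, coeff_expSeries, coeff_expSeries, Odd.neg_pow (by simp)]
  ring

open PowerSeries in
theorem coeff_rescale_oddZetaSeries_mul (c d : ℂ) (n : ℕ) :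
    coeff (2 * n) (rescale c oddZetaSeries * rescale d oddZetaSeries) =
      ∑ j ∈ range (n + 1), ((c ^ 2) ^ j * oddZeta (2 * j + 2)) *
        ((d ^ 2) ^ (n - j) * oddZeta (2 * (n - j) + 2)) := by
  rw [coeff_two_mul_mul_of_odd fun i => by simp [oddZetaSeries, coeff_rescale, parity_simps]]
  simp [oddZetaSeries, coeff_rescale, pow_mul]

open PowerSeries in
theorem coeff_rescale_oddZetaSeries_mul_eq_TSeries {α : ℝ} (hα : 0 < α) (n : ℕ) :
    coeff (2 * n) (rescale (1 / (√α : ℂ)) oddZetaSeries *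
      rescale (Complex.I * (√α : ℂ)) oddZetaSeries) = π / 2 * TSeries (2 * (n : ℝ)) α := by
  have hs : (√α : ℂ) ^ 2 = α := by rw [← Complex.ofReal_pow, Real.sq_sqrt hα.le]
  rw [coeff_rescale_oddZetaSeries_mul, TSeries_two_mul hα, mul_pow, div_pow, one_pow, hs,
    Complex.I_sq]
  have hpi : (π : ℂ) ≠ 0 := by exact_mod_cast Real.pi_ne_zero
  push_cast
  rw [← mul_assoc, show (π : ℂ) / 2 * (2 / π) = 1 by field_simp, one_mul]
  simp

/-- The recursion for `T_{2v,α}` with the `q = v` term on the left. -/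
theorem sum_TSeries_eq {α : ℝ} (hα : 0 < α) (v : ℕ) :
    ∑ q ∈ range (v + 1), (π : ℂ) ^ (2 * v - 2 * q)
        / (((2 * v - 2 * q).factorial : ℂ) * (4 : ℂ) ^ (v - q))
      * ((wPlus α ^ (2 * v - 2 * q) + wMinus α ^ (2 * v - 2 * q)) / 2)
      * TSeries (2 * (q : ℝ)) α =
    1 / ((2 * v).factorial : ℂ)
      * ((π : ℂ) ^ (3 + 2 * v) / ((4 : ℂ) ^ (v + 3) * ((v : ℂ) + 1) * (2 * (v : ℂ) + 1)))
      * ((wPlus α ^ (2 + 2 * v) - wMinus α ^ (2 + 2 * v)) / (2 * Complex.I)) := by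
  have hs0 : (√α : ℂ) ≠ 0 := by exact_mod_cast (Real.sqrt_pos.2 hα).ne'
  have hpi : (π : ℂ) ≠ 0 := by exact_mod_cast Real.pi_ne_zero
  -- The factor X² lowers the degree to 2v on the left, so the convolution ends at q = v.
  have h := congrArg (PowerSeries.coeff (2 * (v + 1)))
    (X_sq_mul_rescale_mul_rescale (1 / (√α : ℂ)) (Complex.I * (√α : ℂ)))
  have ha : Complex.I * π / 2 * (1 / (√α : ℂ) + Complex.I * (√α : ℂ)) = -(π / 2 * wMinus α) := by
    rw [wMinus]
    linear_combination (π / 2 * (√α : ℂ)) * Complex.I_sq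
  have hb : Complex.I * π / 2 * (1 / (√α : ℂ) - Complex.I * (√α : ℂ)) = π / 2 * wPlus α := by
    rw [wPlus]
    linear_combination (-π / 2 * (√α : ℂ)) * Complex.I_sq
  have hodd (i : ℕ) : PowerSeries.coeff (2 * i + 1)
      (expSeries (π / 2 * wMinus α) + expSeries (-(π / 2 * wMinus α)) +
        (expSeries (π / 2 * wPlus α) + expSeries (-(π / 2 * wPlus α)))) = 0 := by
    rw [map_add, coeff_expSeries_add_neg_odd, coeff_expSeries_add_neg_odd, add_zero]
  rw [ha, hb, neg_neg, add_comm (expSeries (-(π / 2 * wMinus α))), PowerSeries.coeff_C_mul,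
    PowerSeries.coeff_C_mul, show 2 * (v + 1) = 2 * v + 2 by lia, PowerSeries.coeff_X_pow_mul,
    coeff_two_mul_mul_of_odd hodd, map_sub, show 2 * v + 2 = 2 * (v + 1) by lia,
    coeff_expSeries_add_neg_even, coeff_expSeries_add_neg_even] at h
  simp only [map_add (PowerSeries.coeff (R := ℂ) _) (expSeries _ + expSeries _),
    coeff_expSeries_add_neg_even, coeff_rescale_oddZetaSeries_mul_eq_TSeries hα] at h
  have hterm : ∀ q ∈ range (v + 1), π / 2 * TSeries (2 * (q : ℝ)) α *
        (2 * (π / 2 * wMinus α) ^ (2 * (v - q)) / ((2 * (v - q)).factorial : ℂ) +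
          2 * (π / 2 * wPlus α) ^ (2 * (v - q)) / ((2 * (v - q)).factorial : ℂ)) =
      (2 * π) * ((π : ℂ) ^ (2 * v - 2 * q)
        / (((2 * v - 2 * q).factorial : ℂ) * (4 : ℂ) ^ (v - q))
      * ((wPlus α ^ (2 * v - 2 * q) + wMinus α ^ (2 * v - 2 * q)) / 2)
      * TSeries (2 * (q : ℝ)) α) := by
    intro q _
    rw [← mul_tsub, mul_pow, mul_pow, div_pow, pow_mul 2 2 (v - q), show (2 : ℂ) ^ 2 = 4 by norm_num]
    have hf : ((2 * (v - q)).factorial : ℂ) ≠ 0 := by exact_mod_cast (Nat.factorial_pos _).ne'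
    field_simp
    ring
  rw [sum_congr rfl hterm, ← mul_sum] at h
  have hf : ((2 * (v + 1)).factorial : ℂ) = 2 * (v + 1) * (2 * v + 1) * (2 * v).factorial := by
    rw [show 2 * (v + 1) = 2 * v + 1 + 1 by lia, Nat.factorial_succ, Nat.factorial_succ]
    push_cast
    ring
  have hf0 : ((2 * v).factorial : ℂ) ≠ 0 := by exact_mod_cast (Nat.factorial_pos _).ne'
  have h1 : (v : ℂ) + 1 ≠ 0 := by exact_mod_cast Nat.succ_ne_zero v
  have h2 : 2 * (v : ℂ) + 1 ≠ 0 := by exact_mod_cast Nat.succ_ne_zero (2 * v)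
  have hI : 16 * (1 / (√α : ℂ) * (Complex.I * (√α : ℂ))) = 16 * Complex.I := by field_simp
  rw [hI, hf, mul_pow, mul_pow, div_pow, pow_mul 2 2 (v + 1), show (2 : ℂ) ^ 2 = 4 by norm_num] at h
  generalize (∑ q ∈ range (v + 1), _ : ℂ) = S at *
  -- This is 16i, from 16cd, times the 2π extracted from each summand.
  have hk : 32 * Complex.I * π ≠ 0 := by simp
  refine mul_left_cancel₀ hk ?_
  rw [show 32 * Complex.I * π * S = 16 * Complex.I * (2 * π * S) by ring, h,
    show 2 + 2 * v = 2 * (v + 1) by lia, show 3 + 2 * v = 2 * (v + 1) + 1 by lia,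
    show v + 3 = v + 1 + 2 by lia, pow_succ, pow_add 4 (v + 1) 2]
  have := Complex.I_ne_zero
  field_simp
  ring

end

/-! ### Convergence and the case α = 1 -/

noncomputable section

/-- Only |tanh| < 1 matters, so an arbitrary argument `f` covers both families of series. -/
theorem summable_tanh_div_odd_rpow {v : ℝ} (hv : 0 ≤ v) (f : ℕ → ℝ) :
    Summable fun m : ℕ => Real.tanh (f m) / (1 + 2 * (m : ℝ)) ^ (3 + v) := by
  refine Summable.of_norm_bounded (summable_one_div_odd_pow (s := 3) (by lia)) fun m => ?_
  have hm : (1 : ℝ) ≤ 1 + 2 * m := by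
    have : (0 : ℝ) ≤ m := m.cast_nonneg
    linarith
  have hp : (1 + 2 * (m : ℝ)) ^ 3 ≤ (1 + 2 * (m : ℝ)) ^ (3 + v) := by
    rw [← Real.rpow_natCast]
    exact Real.rpow_le_rpow_of_exponent_le hm (by push_cast; linarith)
  rw [norm_div, Real.norm_eq_abs, Real.norm_of_nonneg (by positivity)]
  gcongr
  exact (Real.abs_tanh_lt_one _).le

theorem tsum_tanhTerm_one (v : ℝ) : ∑' m, tanhTerm v 1 m = TSquare v :=
  tsum_congr fun m => by rw [tanhTerm, one_mul, mul_div_assoc]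

theorem TSeries_two_mul_one (k : ℕ) :
    TSeries (2 * (k : ℝ)) 1 = (1 + (-1) ^ k) / 2 * TSquare (2 * (k : ℝ)) := by
  rw [TSeries, exp_pi_mul_I_mul_two_mul_div_two, inv_one, tsum_tanhTerm_one, Real.one_rpow,
    Real.one_rpow]
  push_cast
  ring

theorem TSeries_four_mul_one (k : ℕ) :
    TSeries (2 * ((2 * k : ℕ) : ℝ)) 1 = TSquare (4 * (k : ℝ)) := by
  rw [TSeries_two_mul_one, Even.neg_one_pow (by simp)]
  push_cast
  rw [← mul_assoc]
  norm_num

theorem TSeries_two_mul_odd_one (k : ℕ) : TSeries (2 * ((2 * k + 1 : ℕ) : ℝ)) 1 = 0 := by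
  rw [TSeries_two_mul_one, Odd.neg_one_pow (by simp)]
  simp

/-- (1 + i)⁴ = -4. -/
theorem wPlus_one_pow_four_mul (k : ℕ) : wPlus 1 ^ (4 * k) = (-4) ^ k := by
  rw [pow_mul, wPlus, Real.sqrt_one, Complex.ofReal_one, div_one]
  congr 1
  linear_combination (Complex.I ^ 2 + 4 * Complex.I + 5) * Complex.I_sq

theorem wMinus_one_pow_four_mul (k : ℕ) : wMinus 1 ^ (4 * k) = (-4) ^ k := by
  rw [pow_mul, wMinus, Real.sqrt_one, Complex.ofReal_one, div_one]
  congr 1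
  linear_combination (Complex.I ^ 2 - 4 * Complex.I + 5) * Complex.I_sq

theorem wPlus_sq_sub_wMinus_sq_one : wPlus 1 ^ 2 - wMinus 1 ^ 2 = 4 * Complex.I := by
  rw [wPlus, wMinus, Real.sqrt_one, Complex.ofReal_one, div_one]
  ring

theorem sum_TSquare_eq (v : ℕ) :
    ∑ q ∈ range (v + 1), (-1) ^ (v - q) * π ^ (4 * (v - q))
        / (((4 * (v - q)).factorial : ℝ) * 4 ^ (v - q)) * TSquare (4 * (q : ℝ)) =
      (-1) ^ v * π ^ (4 * v + 3)
        / (((4 * v).factorial : ℝ) * 4 ^ (v + 2) * (4 * (v : ℝ) + 1) * (4 * (v : ℝ) + 2)) := by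
  have h := sum_TSeries_eq one_pos (2 * v)
  -- The terms with odd q vanish, since the two halves of T_{2q,1} cancel. The last term q = 2v is
  -- split off so that the remaining range has even length.
  rw [sum_range_succ, sum_range_two_mul_of_odd, ← sum_range_succ
    (fun i => (π : ℂ) ^ (2 * (2 * v) - 2 * (2 * i))
      / (((2 * (2 * v) - 2 * (2 * i)).factorial : ℂ) * (4 : ℂ) ^ (2 * v - 2 * i))
      * ((wPlus 1 ^ (2 * (2 * v) - 2 * (2 * i)) + wMinus 1 ^ (2 * (2 * v) - 2 * (2 * i))) / 2)
      * TSeries (2 * ((2 * i : ℕ) : ℝ)) 1)] at h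
  swap
  · intro i _
    rw [TSeries_two_mul_odd_one, mul_zero]
  have hterm : ∀ i ∈ range (v + 1), (π : ℂ) ^ (2 * (2 * v) - 2 * (2 * i))
      / (((2 * (2 * v) - 2 * (2 * i)).factorial : ℂ) * (4 : ℂ) ^ (2 * v - 2 * i))
      * ((wPlus 1 ^ (2 * (2 * v) - 2 * (2 * i)) + wMinus 1 ^ (2 * (2 * v) - 2 * (2 * i))) / 2)
      * TSeries (2 * ((2 * i : ℕ) : ℝ)) 1 =
      (-1) ^ (v - i) * (π : ℂ) ^ (4 * (v - i))
        / (((4 * (v - i)).factorial : ℂ) * 4 ^ (v - i)) * TSquare (4 * (i : ℝ)) := by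
    intro i _
    rw [show 2 * (2 * v) - 2 * (2 * i) = 4 * (v - i) by lia, ← mul_tsub, pow_mul 4 2,
      wPlus_one_pow_four_mul, wMinus_one_pow_four_mul, TSeries_four_mul_one, neg_pow 4 (v - i),
      sq, mul_pow]
    have hf : ((4 * (v - i)).factorial : ℂ) ≠ 0 := by exact_mod_cast (Nat.factorial_pos _).ne'
    field_simp
    ring
  rw [sum_congr rfl hterm] at h
  rw [← Complex.ofReal_inj]
  push_cast
  rw [h, show 2 + 2 * (2 * v) = 4 * v + 2 by lia, pow_add (wPlus 1), pow_add (wMinus 1),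
    wPlus_one_pow_four_mul, wMinus_one_pow_four_mul, ← mul_sub, wPlus_sq_sub_wMinus_sq_one,
    show 2 * (2 * v) = 4 * v by lia, neg_pow, show 3 + 4 * v = 4 * v + 3 by lia, pow_add 4 (2 * v),
    pow_add 4 v, pow_mul 4 2, sq, mul_pow]
  have hf : ((4 * v).factorial : ℂ) ≠ 0 := by exact_mod_cast (Nat.factorial_pos _).ne'
  have h1 : 4 * (v : ℂ) + 1 ≠ 0 := by exact_mod_cast Nat.succ_ne_zero (4 * v)
  have h2 : 2 * (v : ℂ) + 1 ≠ 0 := by exact_mod_cast Nat.succ_ne_zero (2 * v)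
  have := Complex.I_ne_zero
  rw [show 4 * (v : ℂ) + 2 = 2 * (2 * v + 1) by ring]
  push_cast
  rw [show 2 * (2 * (v : ℂ)) + 1 = 4 * v + 1 by ring]
  field_simp

end

/-! ### Bernoulli numbers and explicit values -/

noncomputable section

/-- The relation ∑_{k<n} C(n,k) B_k = 0 with n = 5 determines B₄ from the earlier values; the later
Bernoulli numbers follow alike. -/
theorem bernoulli_four : bernoulli 4 = -1 / 30 := by
  have h := sum_bernoulli 5
  have h3 := bernoulli_eq_zero_of_odd (n := 3) (by decide) (by lia)
  norm_num [sum_range_succ, Nat.choose, bernoulli_one, bernoulli_two,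
    h3] at h
  linarith

theorem bernoulli_six : bernoulli 6 = 1 / 42 := by
  have h := sum_bernoulli 7
  have h3 := bernoulli_eq_zero_of_odd (n := 3) (by decide) (by lia)
  have h5 := bernoulli_eq_zero_of_odd (n := 5) (by decide) (by lia)
  norm_num [sum_range_succ, Nat.choose, bernoulli_one, bernoulli_two, bernoulli_four,
    h3, h5] at h
  linarith

theorem bernoulli_eight : bernoulli 8 = -1 / 30 := by
  have h := sum_bernoulli 9
  have h3 := bernoulli_eq_zero_of_odd (n := 3) (by decide) (by lia)
  have h5 := bernoulli_eq_zero_of_odd (n := 5) (by decide) (by lia)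
  have h7 := bernoulli_eq_zero_of_odd (n := 7) (by decide) (by lia)
  norm_num [sum_range_succ, Nat.choose, bernoulli_one, bernoulli_two, bernoulli_four, bernoulli_six,
    h3, h5, h7] at h
  linarith

theorem bernoulli_ten : bernoulli 10 = 5 / 66 := by
  have h := sum_bernoulli 11
  have h3 := bernoulli_eq_zero_of_odd (n := 3) (by decide) (by lia)
  have h5 := bernoulli_eq_zero_of_odd (n := 5) (by decide) (by lia)
  have h7 := bernoulli_eq_zero_of_odd (n := 7) (by decide) (by lia)
  have h9 := bernoulli_eq_zero_of_odd (n := 9) (by decide) (by lia)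
  norm_num [sum_range_succ, Nat.choose, bernoulli_one, bernoulli_two, bernoulli_four, bernoulli_six, bernoulli_eight,
    h3, h5, h7, h9] at h
  linarith

theorem bernoulli_twelve : bernoulli 12 = -691 / 2730 := by
  have h := sum_bernoulli 13
  have h3 := bernoulli_eq_zero_of_odd (n := 3) (by decide) (by lia)
  have h5 := bernoulli_eq_zero_of_odd (n := 5) (by decide) (by lia)
  have h7 := bernoulli_eq_zero_of_odd (n := 7) (by decide) (by lia)
  have h9 := bernoulli_eq_zero_of_odd (n := 9) (by decide) (by lia)
  have h11 := bernoulli_eq_zero_of_odd (n := 11) (by decide) (by lia)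
  norm_num [sum_range_succ, Nat.choose, bernoulli_one, bernoulli_two, bernoulli_four, bernoulli_six, bernoulli_eight, bernoulli_ten,
    h3, h5, h7, h9, h11] at h
  linarith

theorem oddZeta_two : oddZeta 2 = π ^ 2 / 8 := by
  have h := oddZeta_two_mul (k := 1) (by lia)
  rw [mul_pow, pow_mul Complex.I, Complex.I_sq] at h
  norm_num [bernoulli_two, Nat.factorial] at h
  rw [← Complex.ofReal_inj, h]
  push_cast
  ring

theorem oddZeta_four : oddZeta 4 = π ^ 4 / 96 := by
  have h := oddZeta_two_mul (k := 2) (by lia)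
  rw [mul_pow, pow_mul Complex.I, Complex.I_sq] at h
  norm_num [bernoulli_four, Nat.factorial] at h
  rw [← Complex.ofReal_inj, h]
  push_cast
  ring

theorem oddZeta_six : oddZeta 6 = π ^ 6 / 960 := by
  have h := oddZeta_two_mul (k := 3) (by lia)
  rw [mul_pow, pow_mul Complex.I, Complex.I_sq] at h
  norm_num [bernoulli_six, Nat.factorial] at h
  rw [← Complex.ofReal_inj, h]
  push_cast
  ring

theorem oddZeta_eight : oddZeta 8 = 17 * π ^ 8 / 161280 := by
  have h := oddZeta_two_mul (k := 4) (by lia)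
  rw [mul_pow, pow_mul Complex.I, Complex.I_sq] at h
  norm_num [bernoulli_eight, Nat.factorial] at h
  rw [← Complex.ofReal_inj, h]
  push_cast
  ring

theorem oddZeta_ten : oddZeta 10 = 31 * π ^ 10 / 2903040 := by
  have h := oddZeta_two_mul (k := 5) (by lia)
  rw [mul_pow, pow_mul Complex.I, Complex.I_sq] at h
  norm_num [bernoulli_ten, Nat.factorial] at h
  rw [← Complex.ofReal_inj, h]
  push_cast
  ring

theorem oddZeta_twelve : oddZeta 12 = 691 * π ^ 12 / 638668800 := by
  have h := oddZeta_two_mul (k := 6) (by lia)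
  rw [mul_pow, pow_mul Complex.I, Complex.I_sq] at h
  norm_num [bernoulli_twelve, Nat.factorial] at h
  rw [← Complex.ofReal_inj, h]
  push_cast
  ring

/-- The explicit T_{2k,α} come from the λ-convolution directly rather than from the recursion. -/
theorem TSeries_zero {α : ℝ} (hα : 0 < α) :
    TSeries 0 α = ((π ^ 3 / 32 : ℝ) : ℂ) := by
  have h := TSeries_two_mul hα 0
  norm_num [sum_range_succ, oddZeta_two] at h
  have hpi : (π : ℂ) ≠ 0 := by exact_mod_cast Real.pi_ne_zero
  rw [h]
  push_cast
  field_simp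
  ring

theorem TSeries_two {α : ℝ} (hα : 0 < α) :
    TSeries 2 α = ((π ^ 5 * ((1 / α - α) / 384) : ℝ) : ℂ) := by
  have h := TSeries_two_mul hα 1
  norm_num [sum_range_succ, oddZeta_two, oddZeta_four] at h
  have hα' : (α : ℂ) ≠ 0 := by exact_mod_cast hα.ne'
  have hpi : (π : ℂ) ≠ 0 := by exact_mod_cast Real.pi_ne_zero
  rw [h]
  push_cast
  field_simp
  ring

theorem TSeries_four {α : ℝ} (hα : 0 < α) :
    TSeries 4 α = ((π ^ 7 * ((6 * (1 / α ^ 2 + α ^ 2) - 5) / 23040) : ℝ) : ℂ) := by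
  have h := TSeries_two_mul hα 2
  norm_num [sum_range_succ, oddZeta_two, oddZeta_four, oddZeta_six] at h
  have hα' : (α : ℂ) ≠ 0 := by exact_mod_cast hα.ne'
  have hpi : (π : ℂ) ≠ 0 := by exact_mod_cast Real.pi_ne_zero
  rw [h]
  push_cast
  field_simp
  ring

theorem TSeries_six {α : ℝ} (hα : 0 < α) :
    TSeries 6 α = ((π ^ 9 * ((17 * (1 / α ^ 3 - α ^ 3) - 14 * (1 / α - α)) / 645120) : ℝ) : ℂ) := by
  have h := TSeries_two_mul hα 3
  norm_num [sum_range_succ, oddZeta_two, oddZeta_four, oddZeta_six, oddZeta_eight] at h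
  have hα' : (α : ℂ) ≠ 0 := by exact_mod_cast hα.ne'
  have hpi : (π : ℂ) ≠ 0 := by exact_mod_cast Real.pi_ne_zero
  rw [h]
  push_cast
  field_simp
  ring

theorem TSeries_eight {α : ℝ} (hα : 0 < α) :
    TSeries 8 α = ((π ^ 11 * ((310 * (1 / α ^ 4 + α ^ 4) - 255 * (1 / α ^ 2 + α ^ 2) + 252)
      / 116121600) : ℝ) : ℂ) := by
  have h := TSeries_two_mul hα 4
  norm_num [sum_range_succ, oddZeta_two, oddZeta_four, oddZeta_six, oddZeta_eight, oddZeta_ten] at h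
  have hα' : (α : ℂ) ≠ 0 := by exact_mod_cast hα.ne'
  have hpi : (π : ℂ) ≠ 0 := by exact_mod_cast Real.pi_ne_zero
  rw [h]
  push_cast
  field_simp
  ring

theorem TSeries_ten {α : ℝ} (hα : 0 < α) :
    TSeries 10 α = ((π ^ 13 * ((2073 * (1 / α ^ 5 - α ^ 5) - 1705 * (1 / α ^ 3 - α ^ 3)
      + 1683 * (1 / α - α)) / 7664025600) : ℝ) : ℂ) := by
  have h := TSeries_two_mul hα 5
  norm_num [sum_range_succ, oddZeta_two, oddZeta_four, oddZeta_six, oddZeta_eight, oddZeta_ten, oddZeta_twelve] at h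
  have hα' : (α : ℂ) ≠ 0 := by exact_mod_cast hα.ne'
  have hpi : (π : ℂ) ≠ 0 := by exact_mod_cast Real.pi_ne_zero
  rw [h]
  push_cast
  field_simp
  ring

end

/-! ### Recursion and values at α = 1, and the full statement -/

theorem TSquare_four_mul (v : ℕ) :
    TSquare (4 * (v : ℝ)) =
      (-1) ^ v * π ^ (4 * v + 3)
          / (((4 * v).factorial : ℝ) * 4 ^ (v + 2) * (4 * (v : ℝ) + 1) * (4 * (v : ℝ) + 2))
        - ∑ q ∈ Finset.range v,
            (-1) ^ (v - q) * π ^ (4 * (v - q))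
                / (((4 * (v - q)).factorial : ℝ) * 4 ^ (v - q))
              * TSquare (4 * (q : ℝ)) := by
  rw [← sum_TSquare_eq, sum_range_succ]
  simp

theorem TSquare_zero : TSquare 0 = π ^ 3 / 32 := by
  have h := TSquare_four_mul 0
  norm_num at h
  exact h

theorem TSquare_four : TSquare 4 = 7 * π ^ 7 / 23040 := by
  have h := TSquare_four_mul 1
  norm_num [sum_range_succ, Nat.factorial, TSquare_zero] at h
  rw [h]
  ring

theorem TSquare_eight : TSquare 8 = 181 * π ^ 11 / 58060800 := by
  have h := TSquare_four_mul 2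
  norm_num [sum_range_succ, Nat.factorial, TSquare_zero, TSquare_four] at h
  rw [h]
  ring

theorem TSquare_twelve : TSquare 12 = 178559 * π ^ 15 / 5579410636800 := by
  have h := TSquare_four_mul 3
  norm_num [sum_range_succ, Nat.factorial, TSquare_zero, TSquare_four, TSquare_eight] at h
  rw [h]
  ring

theorem theorem2p20 :
    -- the series defining `T_{v,α}` and `T_v` converge
    (∀ v α : ℝ, 0 ≤ v → 0 < α → Summable (tanhTerm v α)) ∧
    (∀ v : ℝ, 0 ≤ v → Summable (fun m : ℕ =>
      Real.tanh ((1 + 2 * (m : ℝ)) * π / 2) / (1 + 2 * (m : ℝ)) ^ (3 + v))) ∧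
    -- general `α > 0`
    (∀ α : ℝ, 0 < α →
      (∀ v : ℕ,
        TSeries (2 * (v : ℝ)) α =
          1 / ((2 * v).factorial : ℂ)
              * ((π : ℂ) ^ (3 + 2 * v)
                  / ((4 : ℂ) ^ (v + 3) * ((v : ℂ) + 1) * (2 * (v : ℂ) + 1)))
              * ((wPlus α ^ (2 + 2 * v) - wMinus α ^ (2 + 2 * v)) / (2 * Complex.I))
            - ∑ q ∈ Finset.range v,
                (π : ℂ) ^ (2 * v - 2 * q)
                    / (((2 * v - 2 * q).factorial : ℂ) * (4 : ℂ) ^ (v - q))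
                  * ((wPlus α ^ (2 * v - 2 * q) + wMinus α ^ (2 * v - 2 * q)) / 2)
                  * TSeries (2 * (q : ℝ)) α) ∧
      TSeries 0 α = ((π ^ 3 / 32 : ℝ) : ℂ) ∧
      TSeries 2 α = ((π ^ 5 * ((1 / α - α) / 384) : ℝ) : ℂ) ∧
      TSeries 4 α = ((π ^ 7 * ((6 * (1 / α ^ 2 + α ^ 2) - 5) / 23040) : ℝ) : ℂ) ∧
      TSeries 6 α =
        ((π ^ 9 * ((17 * (1 / α ^ 3 - α ^ 3) - 14 * (1 / α - α)) / 645120) : ℝ) : ℂ) ∧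
      TSeries 8 α =
        ((π ^ 11 * ((310 * (1 / α ^ 4 + α ^ 4) - 255 * (1 / α ^ 2 + α ^ 2) + 252)
          / 116121600) : ℝ) : ℂ) ∧
      TSeries 10 α =
        ((π ^ 13 * ((2073 * (1 / α ^ 5 - α ^ 5) - 1705 * (1 / α ^ 3 - α ^ 3)
          + 1683 * (1 / α - α)) / 7664025600) : ℝ) : ℂ)) ∧
    -- the case `α = 1`
    (∀ v : ℕ,
      TSquare (4 * (v : ℝ)) =
        (-1) ^ v * π ^ (4 * v + 3)
            / (((4 * v).factorial : ℝ) * 4 ^ (v + 2) * (4 * (v : ℝ) + 1) * (4 * (v : ℝ) + 2))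
          - ∑ q ∈ Finset.range v,
              (-1) ^ (v - q) * π ^ (4 * (v - q))
                  / (((4 * (v - q)).factorial : ℝ) * 4 ^ (v - q))
                * TSquare (4 * (q : ℝ))) ∧
    TSquare 0 = π ^ 3 / 32 ∧
    TSquare 4 = 7 * π ^ 7 / 23040 ∧
    TSquare 8 = 181 * π ^ 11 / 58060800 ∧
    TSquare 12 = 178559 * π ^ 15 / 5579410636800 := by
  refine ⟨fun v α hv _ => summable_tanh_div_odd_rpow hv _,
    fun v hv => summable_tanh_div_odd_rpow hv _,
    fun α hα => ⟨fun v => ?_, TSeries_zero hα, TSeries_two hα, TSeries_four hα, TSeries_six hα,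
      TSeries_eight hα, TSeries_ten hα⟩,
    TSquare_four_mul, TSquare_zero, TSquare_four, TSquare_eight, TSquare_twelve⟩
  -- The q = v term has coefficient 1, so isolating it gives the recursion.
  rw [← sum_TSeries_eq hα, sum_range_succ]
  simp
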